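/- For $n\ge 0$ and non-negative integers $a_1,\dots,a_n$ let the Gaussian bracket be defined by $G[\,]=1$, $G[a_1]=a_1$ and $G[a_1,\dots,a_n]=a_n\,G[a_1,\dots,a_{n-1}]+G[a_1,\dots,a_{n-2}]$ for $n\ge 2$. Let $R(a_1,\dots,a_n)$ be the alternating diagram (Conway normal form) of the rational knot or link with conways $a_1,\dots,a_n$: four vertical strands start from two minima placed side by side; then, going upwards, for $j=1,\dots,n$ the two middle strands ($j$ odd) or the two left strands ($j$ even) are twisted around each other with $a_j$ crossings (the $j$-th conway), the handedness of the twists alternating with $j$; finally the four strands are closed by two maxima, side by side if $n$ is odd, nested if $n$ is even. A conway equal to $0$ consists of two untwisted strands. The Conway's function (C-function) of a family of links with $n$ conways is the function of the conways $a_1,\dots,a_n\in\mathbb N\cup\{0\}$ whose value is Conway's number (the determinant) $|\Delta(-1)|$ of the corresponding member of the family, where $\Delta$ is the one-variable Alexander polynomial of the link, for any orientation. Theorem. For $n=2,3,4,5$ the C-function of the family $R(a_1,\dots,a_n)$ of rational knots and links is the Gaussian bracket: the determinant of $R(a_1,\dots,a_n)$ equals $G[a_1,\dots,a_n]$ for all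 integers $a_1,\dots,a_n\ge 0$. -/

import Mathlib

/-!
Link diagrams in the plane, cut by horizontal lines into elementary slices, their Alexander
matrices, and the alternating diagrams of the rational knots and links with given conways.
-/

open scoped LaurentPolynomial

/-- `LinkDiagram m` is the type of the parts, below a horizontal line that meets the diagram in `m`
points, of link diagrams in the plane in general position with respect to the height function. The
points on the line (strands) are numbered `0, …, m - 1` from left to right. Such a part is built
from bottom to top out of local minima, local maxima and crossings. A link diagram is an element of
`LinkDiagram 0`. -/
inductive LinkDiagram : ℕ → Type
  /-- the empty diagram -/
  | empty : LinkDiagram 0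
  /-- a local minimum is added, whose two legs become the strands `i` and `i + 1` -/
  | cup {m : ℕ} (D : LinkDiagram m) (i : Fin (m + 1)) : LinkDiagram (m + 2)
  /-- the strands `i` and `i + 1` are joined by a local maximum -/
  | cap {m : ℕ} (D : LinkDiagram (m + 2)) (i : Fin (m + 1)) : LinkDiagram m
  /-- the strands `i` and `i + 1` cross once; the one that goes from the lower left to the upper
  right passes over the other if `s = true`, and under it if `s = false` -/
  | cross {m : ℕ} (D : LinkDiagram (m + 2)) (i : Fin (m + 1)) (s : Bool) : LinkDiagram (m + 2)

namespace LinkDiagram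

/-- The number of arcs met so far. A new arc begins at each local minimum (with two legs), and at
each crossing, where the upper part of the strand that passes under is a new arc. -/
def arcs : {m : ℕ} → LinkDiagram m → ℕ
  | _, empty => 0
  | _, cup D _ => D.arcs + 1
  | _, cap D _ => D.arcs
  | _, cross D _ _ => D.arcs + 1

/-- The number of the arc (arcs are numbered from `0` in the order of their appearance) to which the
strand in position `j < m` on the top line belongs. Values at `j ≥ m` are meaningless. -/
def label : {m : ℕ} → LinkDiagram m → ℕ → ℕ
  | _, empty, _ => 0
  | _, cup D i, j =>
      if j < i then D.label j
      else if j = i ∨ j = i + 1 then D.arcs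
      else D.label (j - 2)
  | _, cap D i, j => if j < i then D.label j else D.label (j + 2)
  | _, cross D i s, j =>
      if j = i then (if s then D.arcs else D.label (i + 1))
      else if j = i + 1 then (if s then D.label i else D.arcs)
      else D.label j

/-- Let the arcs be directed such that the left leg of a local minimum with arc number `k` is
directed upwards if and only if `o k = true`, the right leg being directed the other way, and such
that directions are carried along through the crossings. Then `D.up o j` tells whether the strand in
position `j < m` on the top line is directed upwards. Values at `j ≥ m` are meaningless. -/
def up (o : ℕ → Bool) : {m : ℕ} → LinkDiagram m → ℕ → Bool
  | _, empty, _ => true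
  | _, cup D i, j =>
      if j < i then D.up o j
      else if j = i then o D.arcs
      else if j = i + 1 then !(o D.arcs)
      else D.up o (j - 2)
  | _, cap D i, j => if j < i then D.up o j else D.up o (j + 2)
  | _, cross D i _, j =>
      if j = i then D.up o (i + 1)
      else if j = i + 1 then D.up o i
      else D.up o j

/-- The directions given by `o` fit together at each local maximum, so that they orient the link. -/
def IsOrientation (o : ℕ → Bool) : {m : ℕ} → LinkDiagram m → Prop
  | _, empty => True
  | _, cup D _ => D.IsOrientation o
  | _, cap D i => D.IsOrientation o ∧ D.up o i ≠ D.up o (i + 1)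
  | _, cross D _ _ => D.IsOrientation o

/-- The rows of the Alexander matrix, i.e. the Fox derivatives of the Wirtinger relations, of an
oriented diagram: a crossing with over-arc `x`, and under-arcs `l` on the left and `r` on the
right of the directed over-arc, gives `(1 - t) x + t l - r`; a local maximum that joins the arcs `p`
and `q` gives `p - q`. -/
def relations {R : Type*} [CommRing R] (t : R) (o : ℕ → Bool) :
    {m : ℕ} → LinkDiagram m → List (ℕ → R)
  | _, empty => []
  | _, cup D _ => D.relations t o
  | _, cap D i =>
      (Pi.single (D.label i) 1 - Pi.single (D.label (i + 1)) 1) :: D.relations t o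
  | _, cross D i s =>
      -- the position of the over-strand below the crossing
      let ov : ℕ := if s then i else i + 1
      -- the under-arcs on the left and on the right of the over-strand, seen upwards
      let lu : ℕ := if s then D.arcs else D.label i
      let ru : ℕ := if s then D.label (i + 1) else D.arcs
      let l : ℕ := if D.up o ov then lu else ru
      let r : ℕ := if D.up o ov then ru else lu
      (Pi.single (D.label ov) (1 - t) + Pi.single l t - Pi.single r 1) :: D.relations t o

/-- The Alexander matrix in the variable `t` of an oriented link diagram. -/
def alexanderMatrix {R : Type*} [CommRing R] (t : R) (o : ℕ → Bool) (D : LinkDiagram 0) :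
    Matrix (Fin (D.relations t o).length) (Fin D.arcs) R :=
  Matrix.of fun i j => (D.relations t o).get i j

/-- `Δ` is the (one-variable) Alexander polynomial, which is defined up to units `±T ^ k`, of the
link diagram `D` with the orientation `o`: up to a unit, it is a minor of the Alexander matrix
whose order is one less than the number of arcs. -/
def IsAlexanderPolynomial (D : LinkDiagram 0) (o : ℕ → Bool) (Δ : ℤ[T;T⁻¹]) : Prop :=
  ∃ (k : ℕ) (f : Fin k → Fin (D.relations (LaurentPolynomial.T 1 : ℤ[T;T⁻¹]) o).length)
    (g : Fin k → Fin D.arcs), k + 1 = D.arcs ∧ Function.Injective f ∧ Function.Injective g ∧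
    Associated Δ ((D.alexanderMatrix (LaurentPolynomial.T 1 : ℤ[T;T⁻¹]) o).submatrix f g).det

/-- The value of a Laurent polynomial with integer coefficients at `-1`. -/
noncomputable def evalNegOne (Δ : ℤ[T;T⁻¹]) : ℤ :=
  LaurentPolynomial.eval₂ (RingHom.id ℤ) (-1 : ℤˣ) Δ

/-- `c` is Conway's number (the determinant) of the link with diagram `D`: the absolute value of the
Alexander polynomial at `-1`, for any orientation. -/
def IsConwayNumber (D : LinkDiagram 0) (c : ℕ) : Prop :=
  (∃ (o : ℕ → Bool) (Δ : ℤ[T;T⁻¹]), D.IsOrientation o ∧ D.IsAlexanderPolynomial o Δ) ∧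
  ∀ (o : ℕ → Bool) (Δ : ℤ[T;T⁻¹]), D.IsOrientation o → D.IsAlexanderPolynomial o Δ →
    (evalNegOne Δ).natAbs = c

/-- `C` is the Conway's function of the family `F` of links with `n` conways: its value at the
conways of a member of the family is Conway's number of this member. -/
def IsConwayFunction {n : ℕ} (F : (Fin n → ℕ) → LinkDiagram 0) (C : (Fin n → ℕ) → ℕ) : Prop :=
  ∀ a : Fin n → ℕ, IsConwayNumber (F a) (C a)

/-- A conway: the strands `i` and `i + 1` are twisted `k` times with handedness `s`. -/
def twist {m : ℕ} (D : LinkDiagram (m + 2)) (i : Fin (m + 1)) (s : Bool) : ℕ → LinkDiagram (m + 2)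
  | 0 => D
  | k + 1 => (D.twist i s k).cross i s

/-- Four strands that start as two minima side by side, followed by the conways
`a 0, a 1, a 2, …`, alternately of the two middle strands and of the two left strands, with
alternating handedness. -/
def rationalTangle : (n : ℕ) → (Fin n → ℕ) → LinkDiagram 4
  | 0, _ => cup (m := 2) (cup (m := 0) empty 0) 2
  | n + 1, a =>
      twist (m := 2) (rationalTangle n fun i => a i.castSucc) (if Even n then 1 else 0)
        (decide (Even n)) (a (Fin.last n))

/-- The alternating diagram (Conway normal form) of the rational knot or link with conways
`a 0, …, a (n - 1)`. The four strands above the last conway are closed such that a last conway of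
several crossings cannot be untwisted: by two maxima side by side if the last conway is one of the
two middle strands (`n` odd), and by two nested maxima otherwise (`n` even). -/
def rational (n : ℕ) (a : Fin n → ℕ) : LinkDiagram 0 :=
  cap (m := 0) (cap (m := 2) (rationalTangle n a) (if Even n then 1 else 0)) 0

end LinkDiagram

/-- The Gaussian bracket `G[a_1, …, a_n]`. -/
def gaussianBracket : (n : ℕ) → (Fin n → ℕ) → ℕ
  | 0, _ => 1
  | 1, a => a 0
  | n + 2, a =>
      a (Fin.last (n + 1)) * gaussianBracket (n + 1) (fun i => a i.castSucc)
        + gaussianBracket n (fun i => a i.castSucc.castSucc)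

/-!
At `t = -1` the relation of a crossing no longer depends on the orientation: it says that twice the
color of the over-arc is the sum of the colors of the two under-arcs. The columns of the Alexander
matrix then add up to zero, and so do its rows, taken with suitable signs, because a horizontal line
that sweeps the diagram changes the alternating sum of the arcs it meets by plus or minus the
relation of what it passes. So all minors of order one less agree up to a unit. One of them is
found by coloring the arcs from bottom to top, starting from the colors `0` and `1` of the two
minima: all relations except those of the maxima hold, the matrix of the crossings is triangular,
and the minor is the color difference of the two strands that the first maximum joins. Twisting two
strands leaves their color difference unchanged and adds a multiple of it to the neighboring one,
which is the recursion of the Gaussian bracket.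
-/

section Minors

open Matrix

variable {R : Type*} [CommRing R] {k : ℕ}

theorem exists_eq_succAbove_comp_perm {f : Fin k → Fin (k + 1)} (hf : Function.Injective f) :
    ∃ (i : Fin (k + 1)) (σ : Equiv.Perm (Fin k)), f = i.succAbove ∘ σ := by
  obtain ⟨i, hi⟩ : ∃ i, ∀ x, f x ≠ i := by
    by_contra! h
    simpa using Fintype.card_le_of_surjective f h
  choose σ hσ using fun x => Fin.exists_succAbove_eq (hi x)
  have hσ_inj : Function.Injective σ := fun x y h => hf (by rw [← hσ, ← hσ, h])
  exact ⟨i, .ofBijective σ hσ_inj.bijective_of_finite, funext fun x => (hσ x).symm⟩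

theorem associated_det_submatrix_of_sum_row_eq_zero {n : Type*} (M : Matrix (Fin (k + 1)) n R)
    (hM : ∀ j, ∑ i, M i j = 0) {f f' : Fin k → Fin (k + 1)} (hf : Function.Injective f)
    (hf' : Function.Injective f') (g : Fin k → n) :
    Associated (M.submatrix f g).det (M.submatrix f' g).det := by
  suffices h : ∀ {f : Fin k → Fin (k + 1)}, Function.Injective f →
      Associated (M.submatrix f g).det (M.submatrix (Fin.succAbove 0) g).det from
    (h hf).trans (h hf').symm
  intro f hf
  obtain ⟨i, σ, rfl⟩ := exists_eq_succAbove_comp_perm hf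
  have hsum : ∑ i, M.submatrix id g i = 0 := by
    ext j
    exact (Finset.sum_apply _ _ _).trans (hM (g j))
  have hperm := det_permute σ (M.submatrix i.succAbove g)
  have hdel := submatrix_succAbove_det_eq_negOnePow_submatrix_succAbove_det _ hsum i 0
  simp only [submatrix_submatrix, Function.comp_id, Function.id_comp] at hperm hdel
  rw [hperm, hdel, Units.smul_def, zsmul_eq_mul, ← mul_assoc]
  have hunit (z : ℤˣ) : IsUnit ((z : ℤ) : R) := z.isUnit.map (Int.castRingHom R)
  exact associated_unit_mul_left _ _ ((hunit _).mul (hunit _))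

theorem associated_det_submatrix_of_vecMul_eq_zero {m n : Type*} [Fintype m]
    (hm : Fintype.card m = k + 1) (M : Matrix m n R) (u : m → Rˣ)
    (hM : (fun i => (u i : R)) ᵥ* M = 0) {f f' : Fin k → m} (hf : Function.Injective f)
    (hf' : Function.Injective f') (g : Fin k → n) :
    Associated (M.submatrix f g).det (M.submatrix f' g).det := by
  let e := Fintype.equivFinOfCardEq hm
  let N : Matrix (Fin (k + 1)) n R := of fun i j => u (e.symm i) * M (e.symm i) j
  have hN (j : n) : ∑ i, N i j = 0 :=
    (e.symm.sum_comp fun i => u i * M i j).trans (congrFun hM j)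
  have hscale (f : Fin k → m) :
      Associated (N.submatrix (e ∘ f) g).det (M.submatrix f g).det := by
    have hdet := det_mul_column (fun a => (u (f a) : R)) (M.submatrix f g)
    have hsub : N.submatrix (e ∘ f) g = of fun a b => (u (f a) : R) * M.submatrix f g a b := by
      ext a b
      simp [N]
    rw [hsub, hdet, ← Units.coe_prod]
    exact associated_unit_mul_left _ _ (Units.isUnit _)
  exact (hscale f).symm.trans ((associated_det_submatrix_of_sum_row_eq_zero N hN
    (e.injective.comp hf) (e.injective.comp hf') g).trans (hscale f'))

theorem associated_det_submatrix {m n : Type*} [Fintype m] [Fintype n]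
    (hm : Fintype.card m = k + 1) (hn : Fintype.card n = k + 1) (M : Matrix m n R)
    (u : m → Rˣ) (hu : (fun i => (u i : R)) ᵥ* M = 0)
    (v : n → Rˣ) (hv : M *ᵥ (fun j => (v j : R)) = 0)
    {f f' : Fin k → m} (hf : Function.Injective f) (hf' : Function.Injective f')
    {g g' : Fin k → n} (hg : Function.Injective g) (hg' : Function.Injective g') :
    Associated (M.submatrix f g).det (M.submatrix f' g').det := by
  have hcol := associated_det_submatrix_of_vecMul_eq_zero hn Mᵀ v
    (by rwa [vecMul_transpose]) hg hg' f'
  rw [← det_transpose, ← det_transpose (Mᵀ.submatrix g' f')] at hcol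
  exact (associated_det_submatrix_of_vecMul_eq_zero hm M u hu hf hf' g).trans hcol

theorem mul_det_eq_adjugate_mul_of_mulVec_eq_single {n : Type*} [Fintype n] [DecidableEq n]
    (M : Matrix n n R) {x : n → R} {i : n} {c : R} (h : M *ᵥ x = Pi.single i c) (j : n) :
    x j * M.det = M.adjugate j i * c := by
  have := congrFun (congrArg (M.adjugate *ᵥ ·) h) j
  simpa [mulVec_mulVec, adjugate_mul, smul_mulVec, mul_comm] using this

theorem associated_det_of_mulVec_eq_single_last (M : Matrix (Fin (k + 1)) (Fin (k + 1)) R)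
    {x : Fin (k + 1) → R} {c : R} (hx : x 0 = 1) (h : M *ᵥ x = Pi.single (Fin.last k) c)
    (htri : (M.submatrix Fin.castSucc Fin.succ).IsLowerTriangular)
    (hdiag : ∀ i : Fin k, IsUnit (M i.castSucc i.succ)) :
    Associated M.det c := by
  have hdet := mul_det_eq_adjugate_mul_of_mulVec_eq_single M h 0
  rw [hx, one_mul, adjugate_fin_succ_eq_det_submatrix, Fin.succAbove_last, Fin.succAbove_zero,
    det_of_isLowerTriangular _ htri] at hdet
  rw [hdet]
  refine associated_unit_mul_left _ _ ((isUnit_one.neg.pow _).mul ?_)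
  exact IsUnit.prod_univ_iff.mpr hdiag

end Minors

/-- The Gaussian bracket `G[a_1, …, a_{n-1}]` without the last argument. The value `0` for `n = 0`
extends the recursion of the Gaussian bracket to `n = 1`. -/
def gaussianBracketInit : (n : ℕ) → (Fin n → ℕ) → ℕ
  | 0, _ => 0
  | n + 1, a => gaussianBracket n fun i => a i.castSucc

theorem gaussianBracket_succ (n : ℕ) (a : Fin (n + 1) → ℕ) :
    gaussianBracket (n + 1) a = a (Fin.last n) * gaussianBracket n (fun i => a i.castSucc)
      + gaussianBracketInit n fun i => a i.castSucc := by
  cases n with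
  | zero => simp [gaussianBracket, gaussianBracketInit]
  | succ n => rfl

/-- The `j`-th of the positions other than `i` and `i + 1`. -/
def skipTwo (i j : ℕ) : ℕ := if j < i then j else j + 2

theorem neg_one_pow_skipTwo {R : Type*} [Ring R] (i j : ℕ) : (-1 : R) ^ skipTwo i j = (-1) ^ j := by
  unfold skipTwo
  split_ifs <;> simp [pow_succ]

theorem sum_range_add_two_eq_sum_skipTwo {A : Type*} [AddCommMonoid A] (f : ℕ → A) {i m : ℕ}
    (hi : i ≤ m) :
    ∑ j ∈ Finset.range (m + 2), f j =
      ∑ j ∈ Finset.range m, f (skipTwo i j) + (f i + f (i + 1)) := by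
  obtain ⟨d, rfl⟩ := Nat.exists_eq_add_of_le hi
  have hbelow : ∑ j ∈ Finset.range i, f (skipTwo i j) = ∑ j ∈ Finset.range i, f j :=
    Finset.sum_congr rfl fun j hj => by rw [skipTwo, if_pos (Finset.mem_range.mp hj)]
  have habove : ∑ j ∈ Finset.range d, f (skipTwo i (i + j)) =
      ∑ j ∈ Finset.range d, f (i + 2 + j) :=
    Finset.sum_congr rfl fun j _ => by rw [skipTwo, if_neg (by omega), Nat.add_right_comm]
  rw [Nat.add_right_comm, Finset.sum_range_add, Finset.sum_range_add _ i d, hbelow, habove,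
    Finset.sum_range_succ, Finset.sum_range_succ]
  abel

theorem sum_range_single_mul {R : Type*} [CommRing R] {N p : ℕ} (hp : p < N) (c : R) (x : ℕ → R) :
    ∑ j ∈ Finset.range N, (Pi.single p c : ℕ → R) j * x j = c * x p := by
  simp [Pi.single_apply, hp]

theorem exists_units_sum_smul_cons {R A : Type*} [Ring R] [AddCommGroup A] [Module R A]
    {L : List A} {r v w : A} (e : Rˣ) (hL : ∃ u : Fin L.length → Rˣ, ∑ i, (u i : R) • L.get i = w)
    (hr : v + (e : R) • r = w) :
    ∃ u : Fin (r :: L).length → Rˣ, ∑ i, (u i : R) • (r :: L).get i = v := by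
  obtain ⟨u, hu⟩ := hL
  refine ⟨(Fin.cons (-e) u : Fin (L.length + 1) → Rˣ), ?_⟩
  refine (Fin.sum_univ_succ (n := L.length) _).trans ?_
  rw [eq_sub_of_add_eq hr, ← hu]
  simp [sub_eq_neg_add]

namespace LinkDiagram

variable {R S : Type*} [CommRing R] [CommRing S] {m : ℕ}

/-- The position, below a crossing of the strands `i` and `i + 1` of handedness `s`, of the strand
that passes over. -/
def overPos (i : ℕ) (s : Bool) : ℕ := if s then i else i + 1

/-- The position, below a crossing of the strands `i` and `i + 1` of handedness `s`, of the strand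
that passes under. -/
def underPos (i : ℕ) (s : Bool) : ℕ := if s then i + 1 else i

theorem overPos_lt (i : Fin (m + 1)) (s : Bool) : overPos i s < m + 2 := by
  unfold overPos
  split_ifs <;> omega

theorem underPos_lt (i : Fin (m + 1)) (s : Bool) : underPos i s < m + 2 := by
  unfold underPos
  split_ifs <;> omega

theorem label_lt_arcs : ∀ {m : ℕ} (D : LinkDiagram m) {j : ℕ}, j < m → D.label j < D.arcs
  | _, empty, j, hj => by omega
  | _, cup D i, j, hj => by
      have ih k := label_lt_arcs D (j := k)
      grind [label, arcs]
  | _, cap D i, j, hj => by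
      have ih k := label_lt_arcs D (j := k)
      grind [label, arcs]
  | _, cross D i s, j, hj => by
      have ih k := label_lt_arcs D (j := k)
      grind [label, arcs]

theorem label_cup_skipTwo (D : LinkDiagram m) (i : Fin (m + 1)) (j : ℕ) :
    (D.cup i).label (skipTwo i j) = D.label j := by
  grind [label, skipTwo]

theorem label_cap (D : LinkDiagram (m + 2)) (i : Fin (m + 1)) (j : ℕ) :
    (D.cap i).label j = D.label (skipTwo i j) := by
  grind [label, skipTwo]

theorem label_cross_skipTwo (D : LinkDiagram (m + 2)) (i : Fin (m + 1)) (s : Bool) (j : ℕ) :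
    (D.cross i s).label (skipTwo i j) = D.label (skipTwo i j) := by
  grind [label, skipTwo]

theorem up_cup_skipTwo (o : ℕ → Bool) (D : LinkDiagram m) (i : Fin (m + 1)) (j : ℕ) :
    (D.cup i).up o (skipTwo i j) = D.up o j := by
  grind [up, skipTwo]

theorem up_cap (o : ℕ → Bool) (D : LinkDiagram (m + 2)) (i : Fin (m + 1)) (j : ℕ) :
    (D.cap i).up o j = D.up o (skipTwo i j) := by
  grind [up, skipTwo]

theorem up_cross (o : ℕ → Bool) (D : LinkDiagram (m + 2)) (i : Fin (m + 1)) (s : Bool) (j : ℕ) :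
    (D.cross i s).up o j = D.up o (Equiv.swap (i : ℕ) (i + 1) j) := by
  grind [up]

theorem relations_map (φ : R →+* S) (t : R) (o : ℕ → Bool) : ∀ {m : ℕ} (D : LinkDiagram m),
    D.relations (φ t) o = (D.relations t o).map fun r j => φ (r j)
  | _, empty => rfl
  | _, cup D _ => relations_map φ t o D
  | _, cap D i => by
      rw [relations, relations, List.map_cons, relations_map φ t o D]
      congr 1
      ext j
      simp [Pi.single_apply, apply_ite φ]
  | _, cross D i s => by
      rw [relations, relations, List.map_cons, relations_map φ t o D]
      congr 1
      ext j
      simp [Pi.single_apply, apply_ite φ]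

theorem relations_apply_eq_zero (t : R) (o : ℕ → Bool) : ∀ {m : ℕ} (D : LinkDiagram m),
    ∀ r ∈ D.relations t o, ∀ j, D.arcs ≤ j → r j = 0
  | _, empty, r, hr, _, _ => by simp [relations] at hr
  | _, cup D _, r, hr, j, hj => relations_apply_eq_zero t o D r hr j (Nat.le_of_succ_le hj)
  | _, cap D i, r, hr, j, hj => by
      rw [arcs] at hj
      rcases List.mem_cons.mp hr with rfl | hr
      · have hl := D.label_lt_arcs (j := i) (by omega)
        have hr := D.label_lt_arcs (j := i + 1) (by omega)
        simp [show j ≠ D.label i by omega, show j ≠ D.label (i + 1) by omega]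
      · exact relations_apply_eq_zero t o D r hr j hj
  | _, cross D i s, r, hr, j, hj => by
      rw [arcs] at hj
      rcases List.mem_cons.mp hr with rfl | hr
      · have hl := D.label_lt_arcs (j := i) (by omega)
        have hr := D.label_lt_arcs (j := i + 1) (by omega)
        simp only [Pi.sub_apply, Pi.add_apply, Pi.single_apply]
        grind
      · exact relations_apply_eq_zero t o D r hr j (by omega)

theorem sum_relation_eq_zero (t : R) (o : ℕ → Bool) {N : ℕ} : ∀ {m : ℕ} (D : LinkDiagram m),
    D.arcs ≤ N → ∀ r ∈ D.relations t o, ∑ j ∈ Finset.range N, r j = 0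
  | _, empty, _, r, hr => by simp [relations] at hr
  | _, cup D _, hN, r, hr => sum_relation_eq_zero t o D (Nat.le_of_succ_le hN) r hr
  | _, cap D i, hN, r, hr => by
      rw [arcs] at hN
      rcases List.mem_cons.mp hr with rfl | hr
      · have hl := D.label_lt_arcs (j := i) (by omega)
        have hr := D.label_lt_arcs (j := i + 1) (by omega)
        simp [Pi.single_apply, hl.trans_le hN, hr.trans_le hN]
      · exact sum_relation_eq_zero t o D hN r hr
  | _, cross D i s, hN, r, hr => by
      rw [arcs] at hN
      rcases List.mem_cons.mp hr with rfl | hr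
      · have hl := D.label_lt_arcs (j := i) (by omega)
        have hr := D.label_lt_arcs (j := i + 1) (by omega)
        have hsum {p : ℕ} (hp : p < N) (c : R) :
            ∑ j ∈ Finset.range N, (Pi.single p c : ℕ → R) j = c := by
          simp [Pi.single_apply, hp]
        simp only [Pi.sub_apply, Pi.add_apply, Finset.sum_sub_distrib, Finset.sum_add_distrib]
        rw [hsum (by split_ifs <;> omega), hsum (by split_ifs <;> omega),
          hsum (by split_ifs <;> omega)]
        ring
      · exact sum_relation_eq_zero t o D (by omega) r hr

theorem relations_neg_one_cross (o : ℕ → Bool) (D : LinkDiagram (m + 2)) (i : Fin (m + 1))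
    (s : Bool) :
    (D.cross i s).relations (-1 : R) o =
      (Pi.single (D.label (overPos i s)) 2 - Pi.single (D.label (underPos i s)) 1
        - Pi.single D.arcs 1) :: D.relations (-1 : R) o := by
  rw [relations]
  congr 1
  ext j
  simp only [Pi.add_apply, Pi.sub_apply, Pi.single_apply, overPos, underPos]
  grind

/-- The sum, with alternating signs, of the generators of the arcs that meet the top line. -/
def alternatingSum (R : Type*) [CommRing R] (D : LinkDiagram m) : ℕ → R :=
  ∑ j ∈ Finset.range m, (-1 : R) ^ j • Pi.single (D.label j) 1

theorem alternatingSum_add_two (D : LinkDiagram (m + 2)) (i : Fin (m + 1)) :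
    D.alternatingSum R =
      ∑ j ∈ Finset.range m, (-1 : R) ^ j • Pi.single (D.label (skipTwo i j)) 1 +
        (-1 : R) ^ (i : ℕ) • (Pi.single (D.label i) 1 - Pi.single (D.label (i + 1)) 1) := by
  rw [alternatingSum, sum_range_add_two_eq_sum_skipTwo _ (Nat.le_of_lt_succ i.isLt)]
  simp only [neg_one_pow_skipTwo, pow_succ, mul_neg_one, neg_smul, ← sub_eq_add_neg, ← smul_sub]

theorem alternatingSum_cup (D : LinkDiagram m) (i : Fin (m + 1)) :
    (D.cup i).alternatingSum R = D.alternatingSum R := by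
  rw [alternatingSum_add_two _ i, alternatingSum]
  simp only [label_cup_skipTwo]
  simp [label]

theorem alternatingSum_cap (D : LinkDiagram (m + 2)) (i : Fin (m + 1)) :
    (D.cap i).alternatingSum R +
      (-1 : R) ^ (i : ℕ) • (Pi.single (D.label i) 1 - Pi.single (D.label (i + 1)) 1) =
        D.alternatingSum R := by
  rw [D.alternatingSum_add_two i, alternatingSum]
  simp only [label_cap]

theorem alternatingSum_cross (D : LinkDiagram (m + 2)) (i : Fin (m + 1)) (s : Bool) :
    (D.cross i s).alternatingSum R + (-1 : R) ^ overPos i s •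
      (Pi.single (D.label (overPos i s)) 2 - Pi.single (D.label (underPos i s)) 1
        - Pi.single D.arcs 1) = D.alternatingSum R := by
  have htwo (p : ℕ) : (Pi.single p 2 : ℕ → R) = Pi.single p 1 + Pi.single p 1 := by
    rw [← Pi.single_add, one_add_one_eq_two]
  rw [D.alternatingSum_add_two i, (D.cross i s).alternatingSum_add_two i, htwo]
  simp only [label_cross_skipTwo]
  cases s <;> simp [label, overPos, underPos, pow_succ, smul_sub] <;> abel

theorem exists_units_sum_smul_relations (o : ℕ → Bool) : ∀ {m : ℕ} (D : LinkDiagram m),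
    ∃ u : Fin (D.relations (-1 : R) o).length → Rˣ,
      ∑ i, (u i : R) • (D.relations (-1 : R) o).get i = D.alternatingSum R
  | _, empty => ⟨fun _ => 1, Finset.sum_eq_zero fun i => i.elim0⟩
  | _, cup D i => by
      rw [alternatingSum_cup]
      exact exists_units_sum_smul_relations o D
  | _, cap D i =>
      exists_units_sum_smul_cons ((-1) ^ (i : ℕ)) (exists_units_sum_smul_relations o D)
        (by simpa using D.alternatingSum_cap i)
  | _, cross D i s => by
      rw [relations_neg_one_cross]
      exact exists_units_sum_smul_cons ((-1) ^ overPos i s)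
        (exists_units_sum_smul_relations o D) (by simpa using D.alternatingSum_cross i s)

theorem associated_minors (D : LinkDiagram 0) (o : ℕ → Bool) {k : ℕ}
    (hrel : (D.relations (-1 : R) o).length = k + 1) (harcs : D.arcs = k + 1)
    {f f' : Fin k → Fin (D.relations (-1 : R) o).length} (hf : Function.Injective f)
    (hf' : Function.Injective f') {g g' : Fin k → Fin D.arcs} (hg : Function.Injective g)
    (hg' : Function.Injective g') :
    Associated ((D.alexanderMatrix (-1 : R) o).submatrix f g).det
      ((D.alexanderMatrix (-1 : R) o).submatrix f' g').det := by
  obtain ⟨u, hu⟩ := exists_units_sum_smul_relations (R := R) o D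
  refine associated_det_submatrix (by simpa using hrel) (by simpa using harcs) _ u ?_ 1 ?_
    hf hf' hg hg'
  · ext j
    have := congrFun hu j
    rw [Finset.sum_apply] at this
    exact this.trans (by simp [alternatingSum])
  · ext i
    have := sum_relation_eq_zero (-1 : R) o D le_rfl _ (List.get_mem _ i)
    rw [Finset.sum_range] at this
    simpa [alexanderMatrix, Matrix.mulVec, dotProduct] using this

/-- The direction of the strand in position `j` on the top line, as a sign: `1` for upwards and
`-1` for downwards. -/
def directionSign (o : ℕ → Bool) (D : LinkDiagram m) (j : ℕ) : ℤ :=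
  if D.up o j then 1 else -1

theorem IsOrientation.sum_directionSign_eq_zero {o : ℕ → Bool} : ∀ {m : ℕ} {D : LinkDiagram m},
    D.IsOrientation o → ∑ j ∈ Finset.range m, D.directionSign o j = 0
  | _, empty, _ => rfl
  | _, cup D i, h => by
      have ih := sum_directionSign_eq_zero (D := D) h
      rw [sum_range_add_two_eq_sum_skipTwo _ (Nat.le_of_lt_succ i.isLt)]
      simp only [directionSign, up_cup_skipTwo] at ih ⊢
      rw [ih]
      cases ho : o D.arcs <;> simp [up, ho]
  | _, cap D i, h => by
      have ih := sum_directionSign_eq_zero h.1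
      have hne := h.2
      rw [sum_range_add_two_eq_sum_skipTwo _ (Nat.le_of_lt_succ i.isLt)] at ih
      simp only [directionSign, ← up_cap] at ih ⊢
      grind
  | m + 2, cross D i _, h => by
      have hsub : {j | Equiv.swap (i : ℕ) (i + 1) j ≠ j} ⊆ Finset.range (m + 2) :=
        fun j (hj : Equiv.swap (i : ℕ) (i + 1) j ≠ j) => by grind
      simp only [directionSign, up_cross]
      exact (Equiv.Perm.sum_comp _ _ (D.directionSign o) hsub).trans
        (sum_directionSign_eq_zero (D := D) h)

theorem IsOrientation.cap_zero {o : ℕ → Bool} {D : LinkDiagram 2} (h : D.IsOrientation o) :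
    (cap (m := 0) D 0).IsOrientation o := by
  refine ⟨h, fun heq => ?_⟩
  have hsum := h.sum_directionSign_eq_zero
  simp only [Finset.sum_range_succ, Finset.sum_range_zero, directionSign] at hsum
  grind

/-- The coloring of the arcs in which the arc number `k` that begins at a minimum has the color
`x k`, and which satisfies the relations of the crossings at `t = -1`: twice the color of the arc
that passes over is the sum of the colors of the two arcs that meet it. -/
def coloring (x : ℕ → R) : {m : ℕ} → LinkDiagram m → ℕ → R
  | _, empty => x
  | _, cup D _ => D.coloring x
  | _, cap D _ => D.coloring x
  | _, cross D i s => Function.update (D.coloring x) D.arcs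
      (2 * D.coloring x (D.label (overPos i s)) - D.coloring x (D.label (underPos i s)))

/-- The color of the strand in position `j` on the top line. -/
def color (x : ℕ → R) (D : LinkDiagram m) (j : ℕ) : R := D.coloring x (D.label j)

/-- The color of the strand in position `j` on the top line minus that of its right neighbor. -/
def colorDiff (x : ℕ → R) (D : LinkDiagram m) (j : ℕ) : R := D.color x j - D.color x (j + 1)

theorem color_cross (x : ℕ → R) (D : LinkDiagram (m + 2)) (i : Fin (m + 1)) (s : Bool) {j : ℕ}
    (hj : j < m + 2) :
    (D.cross i s).color x j = D.color x j +
      if j = i ∨ j = i + 1 then (if s then 1 else -1) * D.colorDiff x i else 0 := by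
  have hj := (D.label_lt_arcs hj).ne
  have hl := (D.label_lt_arcs (j := i) (by omega)).ne
  have hr := (D.label_lt_arcs (j := i + 1) (by omega)).ne
  simp only [colorDiff, color, label, coloring, overPos, underPos]
  cases s <;> split_ifs <;> grind

theorem color_twist (x : ℕ → R) (D : LinkDiagram (m + 2)) (i : Fin (m + 1)) (s : Bool) (k : ℕ)
    {j : ℕ} (hj : j < m + 2) :
    (D.twist i s k).color x j = D.color x j +
      if j = i ∨ j = i + 1 then k * ((if s then 1 else -1) * D.colorDiff x i) else 0 := by
  induction k generalizing j with
  | zero => simp [twist]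
  | succ k ih =>
    have hdiff : (D.twist i s k).colorDiff x i = D.colorDiff x i := by
      rw [colorDiff, ih (by omega), ih (by omega), colorDiff]
      simp
    rw [twist, color_cross x _ i s hj, ih hj, hdiff]
    split_ifs <;> push_cast <;> ring

theorem colorDiff_twist_self (x : ℕ → R) (D : LinkDiagram (m + 2)) (i : Fin (m + 1)) (s : Bool)
    (k : ℕ) : (D.twist i s k).colorDiff x i = D.colorDiff x i := by
  rw [colorDiff, color_twist _ _ _ _ _ (by omega), color_twist _ _ _ _ _ (by omega), colorDiff]
  simp

theorem colorDiff_twist_left (x : ℕ → R) (D : LinkDiagram (m + 2)) (i : Fin (m + 1)) (s : Bool)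
    (k : ℕ) {j : ℕ} (hj : j + 1 = i) :
    (D.twist i s k).colorDiff x j =
      D.colorDiff x j - k * ((if s then 1 else -1) * D.colorDiff x i) := by
  rw [colorDiff, color_twist _ _ _ _ _ (by omega), color_twist _ _ _ _ _ (by omega),
    if_neg (by omega), if_pos (Or.inl hj)]
  simp only [colorDiff]
  ring

theorem colorDiff_twist_right (x : ℕ → R) (D : LinkDiagram (m + 2)) (i : Fin (m + 1)) (s : Bool)
    (k : ℕ) (hi : (i : ℕ) < m) :
    (D.twist i s k).colorDiff x (i + 1) =
      D.colorDiff x (i + 1) + k * ((if s then 1 else -1) * D.colorDiff x i) := by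
  rw [colorDiff, color_twist _ _ _ _ _ (by omega), color_twist _ _ _ _ _ (by omega),
    if_pos (Or.inr rfl), if_neg (c := _ ∨ _) (by omega)]
  simp only [colorDiff]
  ring

theorem colorDiff_rationalTangle (n : ℕ) (a : Fin n → ℕ) :
    (rationalTangle n a).colorDiff (Nat.cast : ℕ → R) (if Even n then 1 else 0) =
        (if Even n then -1 else 1) * gaussianBracket n a ∧
      (rationalTangle n a).colorDiff (Nat.cast : ℕ → R) (if Even n then 0 else 1) =
        (if Even n then 1 else -1) * gaussianBracketInit n a := by
  induction n with
  | zero =>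
    simp [rationalTangle, colorDiff, color, label, coloring, arcs, gaussianBracketInit,
      gaussianBracket]
  | succ n ih =>
    obtain ⟨hlast, hinit⟩ := ih fun i => a i.castSucc
    rw [gaussianBracket_succ, gaussianBracketInit, rationalTangle]
    generalize rationalTangle n (fun i => a i.castSucc) = T at hlast hinit ⊢
    by_cases hn : Even n
    · have hself := T.colorDiff_twist_self (m := 2) (Nat.cast : ℕ → R) 1 true (a (Fin.last n))
      have hleft := T.colorDiff_twist_left (m := 2) (Nat.cast : ℕ → R) 1 true (a (Fin.last n))
        (zero_add 1)
      simp_all [Nat.even_add_one, add_comm]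
    · have hself := T.colorDiff_twist_self (m := 2) (Nat.cast : ℕ → R) 0 false (a (Fin.last n))
      have hright := T.colorDiff_twist_right (m := 2) (Nat.cast : ℕ → R) 0 false (a (Fin.last n))
        two_pos
      simp_all [-Nat.not_even_iff_odd, Nat.even_add_one, add_comm]

/-- Four strands that start from two minima side by side and then cross each other. -/
inductive IsTwoBridge : LinkDiagram 4 → Prop
  | base : IsTwoBridge (cup (m := 2) (cup (m := 0) empty 0) 2)
  | cross {D : LinkDiagram 4} (i : Fin 3) (s : Bool) :
      IsTwoBridge D → IsTwoBridge (cross (m := 2) D i s)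

theorem IsTwoBridge.twist {D : LinkDiagram 4} (hD : D.IsTwoBridge) (i : Fin 3) (s : Bool) :
    ∀ k : ℕ, IsTwoBridge (twist (m := 2) D i s k)
  | 0 => hD
  | k + 1 => (hD.twist i s k).cross i s

theorem isTwoBridge_rationalTangle : ∀ (n : ℕ) (a : Fin n → ℕ), IsTwoBridge (rationalTangle n a)
  | 0, _ => .base
  | n + 1, _ => (isTwoBridge_rationalTangle n _).twist _ _ _

/-- The link diagram in which the strands `i` and `i + 1` are joined by a local maximum, and then
the remaining two strands are. -/
def twoCapClosure (D : LinkDiagram 4) (i : Fin 3) : LinkDiagram 0 :=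
  cap (m := 0) (cap (m := 2) D i) 0

namespace IsTwoBridge

variable {D : LinkDiagram 4}

theorem arcs_eq (hD : D.IsTwoBridge) (t : R) (o : ℕ → Bool) :
    D.arcs = (D.relations t o).length + 2 := by
  induction hD with
  | base => rfl
  | cross i s _ ih => simp [arcs, relations, ih]

theorem coloring_apply_of_lt_two (hD : D.IsTwoBridge) (x : ℕ → R) {j : ℕ} (hj : j < 2) :
    D.coloring x j = x j := by
  induction hD with
  | base => rfl
  | cross i s hD ih =>
    have harcs := hD.arcs_eq (1 : ℤ) fun _ => true
    rw [coloring, Function.update_of_ne (by omega), ih]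

theorem sum_relation_mul_coloring (hD : D.IsTwoBridge) (o : ℕ → Bool) (x : ℕ → R) :
    ∀ r ∈ D.relations (-1) o, ∑ j ∈ Finset.range D.arcs, r j * D.coloring x j = 0 := by
  induction hD with
  | base => simp [relations]
  | @cross D i s _ ih =>
    intro r hr
    have hover := D.label_lt_arcs (overPos_lt i s)
    have hunder := D.label_lt_arcs (underPos_lt i s)
    rw [relations_neg_one_cross, List.mem_cons] at hr
    rw [arcs]
    rcases hr with rfl | hr
    · simp only [Pi.sub_apply, sub_mul, Finset.sum_sub_distrib]
      rw [sum_range_single_mul (by omega), sum_range_single_mul (by omega),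
        sum_range_single_mul (by omega), coloring, Function.update_self,
        Function.update_of_ne hover.ne, Function.update_of_ne hunder.ne]
      ring
    · rw [Finset.sum_range_succ, relations_apply_eq_zero _ o D r hr _ le_rfl, zero_mul, add_zero,
        ← ih r hr]
      refine Finset.sum_congr rfl fun j hj => ?_
      rw [coloring, Function.update_of_ne (Finset.mem_range.mp hj).ne]

theorem relations_get_rev (hD : D.IsTwoBridge) (o : ℕ → Bool) :
    ∀ k : Fin (D.relations (-1 : R) o).length,
      (D.relations (-1) o).get k.rev (k + 2) = -1 ∧
        ∀ j : ℕ, k + 2 < j → (D.relations (-1) o).get k.rev j = 0 := by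
  induction hD with
  | base => exact fun k => k.elim0
  | @cross D i s hD ih =>
    have harcs := hD.arcs_eq (-1 : R) o
    have hover := D.label_lt_arcs (overPos_lt i s)
    have hunder := D.label_lt_arcs (underPos_lt i s)
    rw [relations_neg_one_cross]
    refine Fin.lastCases (n := (D.relations (-1) o).length) ?_ fun k => ?_
    · rw [Fin.rev_last, List.get_cons_zero, Fin.val_last]
      simp only [Pi.sub_apply, Pi.single_apply]
      grind
    · rw [Fin.rev_castSucc]
      exact ih k

theorem isOrientation (hD : D.IsTwoBridge) (o : ℕ → Bool) : D.IsOrientation o := by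
  induction hD with
  | base => trivial
  | cross _ _ _ ih => exact ih

theorem exists_up_ne (hD : D.IsTwoBridge) {p q : ℕ} (hp : p < 4) (hq : q < 4) (hpq : p ≠ q) :
    ∃ o, D.up o p ≠ D.up o q := by
  induction hD generalizing p q with
  | base =>
    refine ⟨fun k => decide (k = 0 ∨ p % 2 ≠ q % 2), ?_⟩
    interval_cases p <;> interval_cases q <;> simp_all [up, arcs]
  | cross i s _ ih =>
    simp only [up_cross (m := 2)]
    exact ih (by grind) (by grind) (by simpa using hpq)

theorem exists_isOrientation (hD : D.IsTwoBridge) (i : Fin 3) :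
    ∃ o, (D.twoCapClosure i).IsOrientation o := by
  obtain ⟨o, ho⟩ := hD.exists_up_ne (p := i) (q := i + 1) (by omega) (by omega) (by omega)
  exact ⟨o, IsOrientation.cap_zero ⟨hD.isOrientation o, ho⟩⟩

end IsTwoBridge

/-- The Alexander matrix at `t = -1` of the closure of `D` that starts by joining the strands `i`
and `i + 1`, without the last relation and the arc `0`. The relations are ordered from bottom to
top, which makes the matrix lower Hessenberg if no minimum lies above a crossing. -/
def reducedMatrix (R : Type*) [CommRing R] (o : ℕ → Bool) (D : LinkDiagram 4) (i : Fin 3) :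
    Matrix (Fin ((D.relations (-1 : R) o).length + 1))
      (Fin ((D.relations (-1 : R) o).length + 1)) R :=
  Matrix.of fun a b => ((cap (m := 2) D i).relations (-1) o).get a.rev (b + 1)

theorem reducedMatrix_castSucc (o : ℕ → Bool) (D : LinkDiagram 4) (i : Fin 3)
    (a : Fin (D.relations (-1 : R) o).length) (b : Fin ((D.relations (-1 : R) o).length + 1)) :
    D.reducedMatrix R o i a.castSucc b = (D.relations (-1) o).get a.rev (b + 1) := by
  rw [reducedMatrix, Matrix.of_apply, Fin.rev_castSucc]
  rfl

theorem reducedMatrix_last (o : ℕ → Bool) (D : LinkDiagram 4) (i : Fin 3)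
    (b : Fin ((D.relations (-1 : R) o).length + 1)) :
    D.reducedMatrix R o i (Fin.last _) b =
      (Pi.single (D.label i) 1 - Pi.single (D.label (i + 1)) 1 : ℕ → R) (b + 1) := by
  rw [reducedMatrix, Matrix.of_apply, Fin.rev_last]
  rfl

theorem exists_submatrix_alexanderMatrix_eq_reducedMatrix (o : ℕ → Bool) (D : LinkDiagram 4)
    (i : Fin 3) (harcs : D.arcs = (D.relations (-1 : R) o).length + 2) :
    ∃ f g, Function.Injective f ∧ Function.Injective g ∧
      ((D.twoCapClosure i).alexanderMatrix (-1 : R) o).submatrix f g =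
        D.reducedMatrix R o i :=
  ⟨fun a => a.rev.succ, fun b => Fin.cast harcs.symm b.succ,
    (Fin.succ_injective _).comp Fin.rev_injective,
    (Fin.cast_injective _).comp (Fin.succ_injective _), rfl⟩

namespace IsTwoBridge

variable {D : LinkDiagram 4}

theorem sum_mul_coloring_succ (hD : D.IsTwoBridge) (o : ℕ → Bool) (r : ℕ → R) :
    ∑ b : Fin ((D.relations (-1 : R) o).length + 1), r (b + 1) * D.coloring Nat.cast (b + 1) =
      ∑ j ∈ Finset.range D.arcs, r j * D.coloring Nat.cast j := by
  rw [hD.arcs_eq (-1 : R) o, Finset.sum_range_succ', hD.coloring_apply_of_lt_two _ two_pos,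
    Finset.sum_range fun j => r (j + 1) * D.coloring Nat.cast (j + 1)]
  simp

theorem reducedMatrix_mulVec (hD : D.IsTwoBridge) (o : ℕ → Bool) (i : Fin 3) :
    (D.reducedMatrix R o i).mulVec (fun b => D.coloring Nat.cast (b + 1)) =
      Pi.single (Fin.last _) (D.colorDiff Nat.cast i) := by
  ext a
  rw [Matrix.mulVec, dotProduct]
  induction a using Fin.lastCases with
  | last =>
    simp only [reducedMatrix_last]
    rw [hD.sum_mul_coloring_succ o]
    simp only [Pi.sub_apply, sub_mul, Finset.sum_sub_distrib]
    rw [sum_range_single_mul (D.label_lt_arcs (by omega)),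
      sum_range_single_mul (D.label_lt_arcs (by omega)), one_mul, one_mul, Pi.single_eq_same]
    rfl
  | cast a =>
    simp only [reducedMatrix_castSucc]
    rw [hD.sum_mul_coloring_succ o, Pi.single_eq_of_ne (Fin.castSucc_ne_last a)]
    exact hD.sum_relation_mul_coloring o _ _ (List.get_mem _ _)

theorem associated_det_reducedMatrix (hD : D.IsTwoBridge) (o : ℕ → Bool) (i : Fin 3) :
    Associated (D.reducedMatrix R o i).det (D.colorDiff Nat.cast i) := by
  refine associated_det_of_mulVec_eq_single_last _ ?_ (hD.reducedMatrix_mulVec o i) ?_ ?_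
  · simpa using hD.coloring_apply_of_lt_two (Nat.cast : ℕ → R) one_lt_two
  · intro a b hab
    rw [Matrix.submatrix_apply, reducedMatrix_castSucc]
    exact (hD.relations_get_rev o a).2 _ (by simpa using hab)
  · intro a
    rw [reducedMatrix_castSucc, Fin.val_succ, (hD.relations_get_rev o a).1]
    exact isUnit_one.neg

theorem associated_minor_colorDiff (hD : D.IsTwoBridge) (o : ℕ → Bool) (i : Fin 3) {k : ℕ}
    (hk : k + 1 = (D.twoCapClosure i).arcs)
    {f : Fin k → Fin ((D.twoCapClosure i).relations (-1 : R) o).length}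
    {g : Fin k → Fin (D.twoCapClosure i).arcs} (hf : Function.Injective f)
    (hg : Function.Injective g) :
    Associated (((D.twoCapClosure i).alexanderMatrix (-1 : R) o).submatrix f g).det
      (D.colorDiff Nat.cast i) := by
  have harcs := hD.arcs_eq (-1 : R) o
  obtain rfl : k = (D.relations (-1 : R) o).length + 1 := Nat.succ_injective (hk.trans harcs)
  obtain ⟨f', g', hf', hg', hminor⟩ :=
    exists_submatrix_alexanderMatrix_eq_reducedMatrix o D i harcs
  refine (associated_minors _ o rfl hk.symm hf hf' hg hg').trans ?_
  rw [hminor]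
  exact hD.associated_det_reducedMatrix o i

end IsTwoBridge

theorem IsAlexanderPolynomial.exists_associated_evalNegOne {D : LinkDiagram 0} {o : ℕ → Bool}
    {Δ : ℤ[T;T⁻¹]} (h : D.IsAlexanderPolynomial o Δ) :
    ∃ (k : ℕ) (f : Fin k → Fin (D.relations (-1 : ℤ) o).length) (g : Fin k → Fin D.arcs),
      k + 1 = D.arcs ∧ Function.Injective f ∧ Function.Injective g ∧
        Associated (evalNegOne Δ) ((D.alexanderMatrix (-1 : ℤ) o).submatrix f g).det := by
  obtain ⟨k, f, g, hk, hf, hg, hΔ⟩ := h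
  let φ : ℤ[T;T⁻¹] →+* ℤ := LaurentPolynomial.eval₂ (RingHom.id ℤ) (-1 : ℤˣ)
  have hrel := relations_map φ (LaurentPolynomial.T 1) o D
  rw [show φ (LaurentPolynomial.T 1) = -1 by simp [φ]] at hrel
  have hlen := (congrArg List.length hrel).trans (List.length_map _)
  have hdet : φ ((D.alexanderMatrix (LaurentPolynomial.T 1) o).submatrix f g).det =
      ((D.alexanderMatrix (-1) o).submatrix (Fin.cast hlen.symm ∘ f) g).det := by
    rw [RingHom.map_det]
    congr 1
    ext a b
    simp [alexanderMatrix, List.getElem_of_eq hrel]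
  exact ⟨k, _, g, hk, (Fin.cast_injective hlen.symm).comp hf, hg, hdet ▸ hΔ.map φ⟩

theorem exists_isAlexanderPolynomial {D : LinkDiagram 0} {o : ℕ → Bool} (hpos : 0 < D.arcs)
    (hlen : D.arcs ≤ (D.relations (LaurentPolynomial.T 1 : ℤ[T;T⁻¹]) o).length + 1) :
    ∃ Δ, D.IsAlexanderPolynomial o Δ :=
  ⟨_, D.arcs - 1, Fin.castLE (by omega), Fin.castLE (by omega), by omega,
    Fin.castLE_injective _, Fin.castLE_injective _, Associated.refl _⟩

theorem IsTwoBridge.isConwayNumber_twoCapClosure {D : LinkDiagram 4} (hD : D.IsTwoBridge)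
    (i : Fin 3) :
    (D.twoCapClosure i).IsConwayNumber (D.colorDiff (Nat.cast : ℕ → ℤ) i).natAbs := by
  constructor
  · obtain ⟨o, ho⟩ := hD.exists_isOrientation i
    have harcs := hD.arcs_eq (LaurentPolynomial.T 1 : ℤ[T;T⁻¹]) o
    obtain ⟨Δ, hΔ⟩ := exists_isAlexanderPolynomial (D := D.twoCapClosure i) (o := o)
      (harcs ▸ Nat.succ_pos _) (harcs.le.trans (Nat.le_succ _))
    exact ⟨o, Δ, ho, hΔ⟩
  · rintro o Δ - hΔ
    obtain ⟨k, f, g, hk, hf, hg, hminor⟩ := hΔ.exists_associated_evalNegOne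
    exact Int.associated_iff_natAbs.mp (hminor.trans (hD.associated_minor_colorDiff o i hk hf hg))

end LinkDiagram

open LinkDiagram in
theorem theorem1_general (n : ℕ) : IsConwayFunction (rational n) (gaussianBracket n) := by
  intro a
  have hconway : (rational n a).IsConwayNumber _ :=
    (isTwoBridge_rationalTangle n a).isConwayNumber_twoCapClosure (if Even n then 1 else 0)
  rw [apply_ite Fin.val, Fin.val_one, Fin.val_zero, (colorDiff_rationalTangle n a).1] at hconway
  split_ifs at hconway <;> simpa using hconway

theorem theorem1 (n : ℕ) (hn : 2 ≤ n) (hn' : n ≤ 5) :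
    LinkDiagram.IsConwayFunction (LinkDiagram.rational n) (gaussianBracket n) :=
  theorem1_general n
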